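/- Let $\mathbb K$ be $\mathbb R$ or $\mathbb C$ and let $\widetilde{\mathbb K}=\mathcal E_M(\mathbb K)/\mathcal N(\mathbb K)$ be the ring of Colombeau generalized numbers, where $\mathcal E_M(\mathbb K)$ is the ring (under pointwise operations) of all nets $(x_\varepsilon)_\varepsilon\in\mathbb K^{(0,1)}$ for which there exist $a\in\mathbb R$ and $\varepsilon_0\in(0,1)$ such that $|x_\varepsilon|\le\varepsilon^a$ for all $\varepsilon\in(0,1)$ with $\varepsilon\le\varepsilon_0$, and $\mathcal N(\mathbb K)$ is the ideal of all nets such that for every $a\in\mathbb R$ there exists $\varepsilon_0\in(0,1)$ with $|x_\varepsilon|\le\varepsilon^a$ for all $\varepsilon\in(0,1)$ with $\varepsilon\le\varepsilon_0$. For every ideal $I$ of $\widetilde{\mathbb K}$, the following are equivalent: 1. $I$ is projective, i.e. $I$ is a projective $\widetilde{\mathbb K}$-module; 2. $I$ is an (internal) direct sum of principal ideals generated by idempotents, i.e. there is a family $(e_i)_{i\in\Lambda}$ of idempotents of $\widetilde{\mathbb K}$ with $I=\bigoplus_{i\in\Lambda}e_i\widetilde{\mathbb K}$; 3. $I$ is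 generated by a family $(e_i)_{i\in\Lambda}$ of mutually orthogonal idempotents, i.e. $e_i^2=e_i$ for all $i$ and $e_ie_j=0$ for all $i\ne j$. The index set $\Lambda$ is arbitrary (possibly empty or infinite). -/

import Mathlib

universe u v

namespace Colombeau

/-- `x` is bounded by `ε ^ a` for all sufficiently small `ε` in the interval `(0,1)`. -/
def EventuallyLe {𝕜 : Type*} [RCLike 𝕜] (x : Set.Ioo (0 : ℝ) 1 → 𝕜) (a : ℝ) : Prop :=
  ∃ ε₀ : Set.Ioo (0 : ℝ) 1, ∀ ε : Set.Ioo (0 : ℝ) 1, ε ≤ ε₀ → ‖x ε‖ ≤ (ε : ℝ) ^ a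

theorem EventuallyLe.zero {𝕜 : Type*} [RCLike 𝕜] (a : ℝ) :
    EventuallyLe (0 : Set.Ioo (0 : ℝ) 1 → 𝕜) a := by
  refine ⟨⟨1 / 2, by norm_num, by norm_num⟩, fun ε _ => ?_⟩
  simpa using Real.rpow_nonneg ε.2.1.le a

theorem EventuallyLe.one {𝕜 : Type*} [RCLike 𝕜] :
    EventuallyLe (1 : Set.Ioo (0 : ℝ) 1 → 𝕜) 0 := by
  refine ⟨⟨1 / 2, by norm_num, by norm_num⟩, fun ε _ => ?_⟩
  simp

theorem EventuallyLe.neg {𝕜 : Type*} [RCLike 𝕜] {x : Set.Ioo (0 : ℝ) 1 → 𝕜} {a : ℝ}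
    (hx : EventuallyLe x a) : EventuallyLe (-x) a := by
  obtain ⟨ε₀, h⟩ := hx
  exact ⟨ε₀, fun ε hε => by simpa using h ε hε⟩

theorem EventuallyLe.mul {𝕜 : Type*} [RCLike 𝕜] {x y : Set.Ioo (0 : ℝ) 1 → 𝕜} {a b : ℝ}
    (hx : EventuallyLe x a) (hy : EventuallyLe y b) : EventuallyLe (x * y) (a + b) := by
  obtain ⟨ε₁, h₁⟩ := hx
  obtain ⟨ε₂, h₂⟩ := hy
  refine ⟨min ε₁ ε₂, fun ε hε => ?_⟩
  rw [Pi.mul_apply, norm_mul, Real.rpow_add ε.2.1]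
  exact mul_le_mul (h₁ ε (hε.trans (min_le_left _ _))) (h₂ ε (hε.trans (min_le_right _ _)))
    (norm_nonneg _) (Real.rpow_nonneg ε.2.1.le a)

theorem EventuallyLe.add {𝕜 : Type*} [RCLike 𝕜] {x y : Set.Ioo (0 : ℝ) 1 → 𝕜} {a b : ℝ}
    (hx : EventuallyLe x a) (hy : EventuallyLe y b) : EventuallyLe (x + y) (min a b - 1) := by
  obtain ⟨ε₁, h₁⟩ := hx
  obtain ⟨ε₂, h₂⟩ := hy
  refine ⟨min (min ε₁ ε₂) ⟨1 / 2, by norm_num, by norm_num⟩, fun ε hε => ?_⟩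
  have hε0 : (0 : ℝ) < ε := ε.2.1
  have k₁ := h₁ ε (hε.trans ((min_le_left _ _).trans (min_le_left _ _)))
  have k₂ := h₂ ε (hε.trans ((min_le_left _ _).trans (min_le_right _ _)))
  have k₃ : (ε : ℝ) ≤ 1 / 2 := hε.trans (min_le_right _ _)
  have m₁ : (ε : ℝ) ^ a ≤ (ε : ℝ) ^ (min a b) :=
    Real.rpow_le_rpow_of_exponent_ge hε0 ε.2.2.le (min_le_left _ _)
  have m₂ : (ε : ℝ) ^ b ≤ (ε : ℝ) ^ (min a b) :=
    Real.rpow_le_rpow_of_exponent_ge hε0 ε.2.2.le (min_le_right _ _)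
  have hp : 0 ≤ (ε : ℝ) ^ (min a b) := Real.rpow_nonneg hε0.le _
  rw [Real.rpow_sub hε0, Real.rpow_one, le_div_iff₀ hε0, Pi.add_apply]
  have := norm_add_le (x ε) (y ε)
  nlinarith [norm_nonneg (x ε + y ε)]

/-- The ring `ℰ_M(𝕜)` of moderate nets `(x_ε)`, `ε ∈ (0,1)`: for some real `a`,
`‖x_ε‖ ≤ ε ^ a` for all sufficiently small `ε`. -/
def moderate (𝕜 : Type*) [RCLike 𝕜] : Subring (Set.Ioo (0 : ℝ) 1 → 𝕜) where
  carrier := {x | ∃ a : ℝ, EventuallyLe x a}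
  zero_mem' := ⟨0, EventuallyLe.zero 0⟩
  one_mem' := ⟨0, EventuallyLe.one⟩
  add_mem' := fun ⟨_, hx⟩ ⟨_, hy⟩ => ⟨_, hx.add hy⟩
  mul_mem' := fun ⟨_, hx⟩ ⟨_, hy⟩ => ⟨_, hx.mul hy⟩
  neg_mem' := fun ⟨_, hx⟩ => ⟨_, hx.neg⟩

/-- The ideal `𝒩(𝕜)` of negligible nets: for every real `a`,
`‖x_ε‖ ≤ ε ^ a` for all sufficiently small `ε`. (Such nets are moderate.) -/
def negligible (𝕜 : Type*) [RCLike 𝕜] : Ideal (moderate 𝕜) where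
  carrier := {x | ∀ a : ℝ, EventuallyLe (x : Set.Ioo (0 : ℝ) 1 → 𝕜) a}
  zero_mem' := fun a => EventuallyLe.zero a
  add_mem' := fun {x y} hx hy a => by
    have h := (hx (a + 1)).add (hy (a + 1))
    rw [min_self, add_sub_cancel_right] at h
    exact h
  smul_mem' := fun c x hx a => by
    obtain ⟨b, hb⟩ := c.2
    have h := hb.mul (hx (a - b))
    rw [add_sub_cancel] at h
    exact h

/-- The ring of Colombeau generalized numbers over `𝕜` (which is `ℝ` or `ℂ`). -/
abbrev GenNumber (𝕜 : Type*) [RCLike 𝕜] : Type _ :=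
  moderate 𝕜 ⧸ negligible 𝕜

/-- The ideal `I` is the (internal) direct sum of the ideals `J i`: the `J i` are independent
(each meets the sum of the others only in `0`) and their sum is `I`. -/
def IsDirectSumOf {R : Type*} [CommRing R] {ι : Type*} (I : Ideal R) (J : ι → Ideal R) : Prop :=
  iSupIndep J ∧ ⨆ i, J i = I

end Colombeau

-- Conditions 2 and 3 agree over any commutative ring: `e i * e j` lies in both ideals, and
-- multiplication by `e i` fixes its own summand and kills the others. Given 3, the map `x ↦ (x * e
-- i)` splits the surjection from the free module on the index set, so the ideal is projective.
--
-- Conversely, a section `s` of the free module on the set `I` over `I` yields `t p = s p p`, with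
-- `x = ∑ x * t p` a finite sum for each `x ∈ I`: a locally finite partition of unity. Three
-- properties of the ring (exchange idempotents, a combination of any two elements with their common
-- annihilator, nonzerodivisors are units) show that each `x ∈ I` is fixed by an idempotent of `I`
-- and that `t p ∈ I`. Join `p` and `q` when `t p * t q ≠ 0`. This graph is locally finite, so its
-- components are countable. Cutting along components gives idempotents generating `I` that are
-- orthogonal across components; inside a component they are enumerated and made orthogonal one
-- after another.

namespace Colombeau

-- Direct sums of idempotent ideals and their projectivity

section DirectSum

variable {R : Type*} [CommRing R] {ι : Type*}

theorem mul_eq_of_mem_span_idempotent {e x : R} (he : IsIdempotentElem e)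
    (hx : x ∈ Ideal.span {e}) : x * e = x := by
  obtain ⟨c, rfl⟩ := Ideal.mem_span_singleton'.1 hx
  rw [mul_assoc, he.eq]

/-- For principal ideals generated by idempotents, being an internal direct sum means that the
idempotents are mutually orthogonal. -/
theorem isDirectSumOf_span_singleton_iff {I : Ideal R} {e : ι → R}
    (he : ∀ i, IsIdempotentElem (e i)) :
    IsDirectSumOf I (fun i => Ideal.span {e i}) ↔
      (∀ i j, i ≠ j → e i * e j = 0) ∧ Ideal.span (Set.range e) = I := by
  have hs : ⨆ i, Ideal.span {e i} = Ideal.span (Set.range e) := by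
    rw [← Set.iUnion_singleton_eq_range, Ideal.span_iUnion]
  unfold IsDirectSumOf
  rw [hs]
  refine and_congr_left fun _ => ⟨fun h i j hij => ?_, fun h i => ?_⟩
  · have hd := (h.pairwiseDisjoint hij).le_bot
      (x := e i * e j) ⟨Ideal.mul_mem_right _ _ (Ideal.mem_span_singleton_self _),
        Ideal.mul_mem_left _ _ (Ideal.mem_span_singleton_self _)⟩
    simpa using hd
  · rw [Submodule.disjoint_def]
    intro x hx hx'
    rw [← mul_eq_of_mem_span_idempotent (he i) hx]
    -- Multiplication by `e i` kills every other summand but fixes `x`.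
    have hle : (⨆ j, ⨆ (_ : j ≠ i), Ideal.span {e j}) ≤ LinearMap.ker (LinearMap.mulRight R (e i)) :=
      iSup₂_le fun j hj => by
        rw [Ideal.span_le, Set.singleton_subset_iff]
        simpa using h j i hj
    simpa using hle hx'

/-- An ideal generated by mutually orthogonal idempotents is projective. -/
theorem projective_of_orthogonal_idempotents {I : Ideal R} {e : ι → R}
    (he : ∀ i, IsIdempotentElem (e i)) (ho : ∀ i j, i ≠ j → e i * e j = 0)
    (hI : Ideal.span (Set.range e) = I) : Module.Projective R I := by
  classical
  subst hI
  have hmem : ∀ i, e i ∈ Ideal.span (Set.range e) := fun i => Ideal.subset_span ⟨i, rfl⟩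
  -- The canonical coordinates `x * e i` are finitely supported, because by orthogonality only
  -- indices from a finite expression of `x` contribute. Being determined by `x`, they are linear in
  -- `x` and define the section `s`.
  have key : ∀ x ∈ Ideal.span (Set.range e), ∃ c : ι →₀ R,
      (∀ i, c i = x * e i) ∧ c.sum (fun i a => a * e i) = x := by
    intro x hx
    obtain ⟨c, rfl⟩ := (Finsupp.mem_ideal_span_range_iff_exists_finsupp).1 hx
    have hc : ∀ i, (c.sum fun i a => a * e i) * e i = c i * e i := by
      intro i
      rw [Finsupp.sum, Finset.sum_mul, Finset.sum_eq_single i]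
      · rw [mul_assoc, (he i).eq]
      · intro j _ hj
        rw [mul_assoc, ho j i hj, mul_zero]
      · intro hi
        simp [Finsupp.notMem_support_iff.1 hi]
    have hci : ∀ i ∉ c.support, c i * e i = 0 := fun i hi => by
      simp [Finsupp.notMem_support_iff.1 hi]
    refine ⟨Finsupp.onFinset c.support (fun i => c i * e i) fun i hi => by
      by_contra h
      exact hi (hci i h), fun i => (hc i).symm, ?_⟩
    rw [Finsupp.onFinset_sum _ fun i => zero_mul _]
    exact Finset.sum_congr rfl fun i _ => by rw [mul_assoc, (he i).eq]
  choose! c hc hcs using key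
  let s : Ideal.span (Set.range e) →ₗ[R] ι →₀ R :=
    { toFun := fun x => c x
      map_add' := fun x y => by
        ext i
        simp [hc _ x.2, hc _ y.2, hc _ (add_mem x.2 y.2), add_mul]
      map_smul' := fun r x => by
        ext i
        simp [hc _ x.2, hc _ (Ideal.mul_mem_left _ r x.2), mul_assoc] }
  let p : (ι →₀ R) →ₗ[R] Ideal.span (Set.range e) :=
    Finsupp.linearCombination R fun i => ⟨e i, hmem i⟩
  refine Module.Projective.of_split s p (LinearMap.ext fun x => Subtype.ext ?_)
  have := hcs x x.2
  simp [s, p, Finsupp.linearCombination_apply, Finsupp.sum] at this ⊢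
  exact this

end DirectSum

-- Making generating idempotents orthogonal

section Orthogonalize

variable {R : Type*} [CommRing R] {ι : Type*}

/-- The vertices reachable from a given one in a locally finite graph form a countable set. -/
theorem countable_setOf_reflTransGen {r : ι → ι → Prop} (hr : ∀ i, {j | r i j}.Finite) (i : ι) :
    {j | Relation.ReflTransGen r i j}.Countable := by
  let S : ℕ → Set ι := fun n => n.rec {i} fun _ T => ⋃ j ∈ T, {k | r j k}
  have hS : ∀ n, (S n).Countable := by
    intro n
    induction n with
    | zero => exact Set.countable_singleton i
    | succ n ih => exact ih.biUnion fun j _ => (hr j).countable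
  refine (Set.countable_iUnion hS).mono fun j hj => ?_
  induction hj with
  | refl => exact Set.mem_iUnion.2 ⟨0, rfl⟩
  | tail _ hbc ih =>
    obtain ⟨n, hn⟩ := Set.mem_iUnion.1 ih
    exact Set.mem_iUnion.2 ⟨n + 1, Set.mem_biUnion hn hbc⟩

theorem one_sub_prod_one_sub_mem {J : Ideal R} {h : ι → R} (s : Finset ι)
    (hs : ∀ j ∈ s, h j ∈ J) : 1 - ∏ j ∈ s, (1 - h j) ∈ J := by
  rw [← Ideal.Quotient.eq, map_prod, map_one]
  refine (Finset.prod_eq_one fun j hj => ?_).symm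
  rw [map_sub, map_one, Ideal.Quotient.eq_zero_iff_mem.2 (hs j hj), sub_zero]

/-- If idempotents `h i` are orthogonal for indices in different classes of an equivalence
relation all of whose classes are countable, then the ideal they generate is generated by
mutually orthogonal idempotents. -/
theorem exists_orthogonal_idempotents_of_countable_classes (r : Setoid ι)
    (hc : ∀ i, {j | r i j}.Countable) {h : ι → R} (hi : ∀ i, IsIdempotentElem (h i))
    (ho : ∀ i j, ¬ r i j → h i * h j = 0) :
    ∃ k : ι → R, (∀ i, IsIdempotentElem (k i)) ∧ (∀ i j, i ≠ j → k i * k j = 0) ∧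
      Ideal.span (Set.range k) = Ideal.span (Set.range h) := by
  classical
  have hn : ∀ q : Quotient r, ∃ f : ι → ℕ, Set.InjOn f {j | r q.out j} := fun q =>
    Set.countable_iff_exists_injOn.1 (hc _)
  choose f hf using hn
  -- Numbers the elements injectively within each class, so each has finitely many predecessors
  -- there.
  let n : ι → ℕ := fun i => f ⟦i⟧ i
  have hinj : ∀ i j, r i j → n i = n j → i = j := by
    intro i j hij hnij
    have hq : (⟦i⟧ : Quotient r) = ⟦j⟧ := Quotient.sound hij
    refine hf ⟦i⟧ (Quotient.mk_out i) (r.trans (Quotient.mk_out i) hij) ?_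
    simpa [n, ← hq] using hnij
  have hfin : ∀ i, {j | r i j ∧ n j < n i}.Finite := by
    intro i
    refine Set.Finite.of_finite_image ((Set.finite_lt_nat (n i)).subset ?_)
      (f := n) fun a ha b hb hab => hinj a b (r.trans (r.symm ha.1) hb.1) hab
    rintro _ ⟨j, hj, rfl⟩
    exact hj.2
  -- Remove from `h i` what its predecessors cover, as when making sets disjoint.
  let k : ι → R := fun i => h i * ∏ j ∈ (hfin i).toFinset, (1 - h j)
  have hlt : ∀ i j, r i j → n i < n j → h i * k j = 0 := by
    intro i j hij hlt
    have hmem : i ∈ (hfin j).toFinset := by simpa using ⟨r.symm hij, hlt⟩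
    simp only [k]
    rw [← Finset.mul_prod_erase _ _ hmem]
    linear_combination (-(h j * ∏ x ∈ (hfin j).toFinset.erase i, (1 - h x))) * (hi i).eq
  refine ⟨k, fun i => ?_, fun i j hij => ?_, le_antisymm ?_ ?_⟩
  · refine (hi i).mul ?_
    rw [IsIdempotentElem, ← Finset.prod_mul_distrib]
    exact Finset.prod_congr rfl fun j _ => (hi j).one_sub.eq
  · by_cases hr : r i j
    · rcases lt_or_gt_of_ne (fun hE => hij (hinj i j hr hE)) with hl | hl
      · have := hlt i j hr hl
        simp only [k] at this ⊢
        linear_combination (∏ j ∈ (hfin i).toFinset, (1 - h j)) * this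
      · have := hlt j i (r.symm hr) hl
        simp only [k] at this ⊢
        linear_combination (∏ x ∈ (hfin j).toFinset, (1 - h x)) * this
    · have := ho i j hr
      simp only [k]
      linear_combination (∏ j ∈ (hfin i).toFinset, (1 - h j)) *
        (∏ x ∈ (hfin j).toFinset, (1 - h x)) * this
  · rw [Ideal.span_le]
    rintro _ ⟨i, rfl⟩
    exact Ideal.mul_mem_right _ _ (Ideal.subset_span ⟨i, rfl⟩)
  · rw [Ideal.span_le]
    rintro _ ⟨i, rfl⟩
    -- `h i - k i` is a multiple of `1 - ∏ (1 - h j)`, which lies in the ideal generated by the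
    -- predecessors `h j`.
    induction hN : n i using Nat.strong_induction_on generalizing i with
    | _ N ih =>
      have h1 := one_sub_prod_one_sub_mem (J := Ideal.span (Set.range k)) (h := h)
        (hfin i).toFinset fun j hj => by
          rw [Set.Finite.mem_toFinset] at hj
          exact ih (n j) (hN ▸ hj.2) j rfl
      have h2 : k i ∈ Ideal.span (Set.range k) := Ideal.subset_span ⟨i, rfl⟩
      have h3 : h i = k i + h i * (1 - ∏ j ∈ (hfin i).toFinset, (1 - h j)) := by
        simp only [k]; ring
      rw [h3]
      exact add_mem h2 (Ideal.mul_mem_left _ _ h1)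

/-- An ideal with enough idempotents and a locally finite partition of unity is generated by
mutually orthogonal idempotents. -/
theorem exists_orthogonal_idempotents_of_partition {I : Ideal R} {t : ι → R} (ht : ∀ i, t i ∈ I)
    (hidem : ∀ x ∈ I, ∃ e ∈ I, IsIdempotentElem e ∧ x * e = x)
    (hpart : ∀ x ∈ I, ∃ F : Finset ι, (∀ i ∉ F, x * t i = 0) ∧ ∑ i ∈ F, x * t i = x) :
    ∃ k : ι → R, (∀ i, IsIdempotentElem (k i)) ∧ (∀ i j, i ≠ j → k i * k j = 0) ∧
      Ideal.span (Set.range k) = I := by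
  classical
  let r : ι → ι → Prop := fun i j => t i * t j ≠ 0
  have hrs : Std.Symm r := ⟨fun i j hij => by simpa [r, mul_comm] using hij⟩
  have hr : ∀ i, {j | r i j}.Finite := by
    intro i
    obtain ⟨F, hF, -⟩ := hpart (t i) (ht i)
    exact F.finite_toSet.subset fun j hj => by
      by_contra hjF
      exact hj (hF j hjF)
  let S : Setoid ι :=
    ⟨Relation.ReflTransGen r, fun _ => .refl, fun {x y} hxy => Std.Symm.symm (r := Relation.ReflTransGen r) x y hxy, fun hxy hyz => hxy.trans hyz⟩
  have hS : ∀ i j, ¬ S i j → t i * t j = 0 := fun i j hij => by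
    by_contra hne
    exact hij (Relation.ReflTransGen.single hne)
  choose g hgI hg hgt using fun i => hidem (t i) (ht i)
  choose F hF hFs using fun i => hpart (g i) (hgI i)
  -- `g i` splits into the part `h i` over the component of `i` and the rest `h' i`. Products across
  -- components vanish, so `h i * h' i = 0`, which makes `h i` idempotent, and `t i * h' i = 0`, so
  -- `h i` still fixes `t i`.
  let h : ι → R := fun i => ∑ j ∈ F i with S i j, g i * t j
  let h' : ι → R := fun i => ∑ j ∈ F i with ¬ S i j, g i * t j
  have hh : ∀ i, h i + h' i = g i := fun i => by
    simp only [h, h']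
    rw [Finset.sum_filter_add_sum_filter_not, hFs]
  have hhh : ∀ i, h i * h' i = 0 := fun i => by
    simp only [h, h', Finset.sum_mul_sum]
    refine Finset.sum_eq_zero fun a ha => Finset.sum_eq_zero fun b hb => ?_
    rw [Finset.mem_filter] at ha hb
    have := hS a b fun hab => hb.2 (S.trans ha.2 hab)
    linear_combination g i * g i * this
  have hhg : ∀ i, h i * g i = h i := fun i => by
    simp only [h, Finset.sum_mul]
    exact Finset.sum_congr rfl fun j _ => by linear_combination t j * (hg i).eq
  have hth : ∀ i, t i * h i = t i := fun i => by
    have h0 : t i * h' i = 0 := by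
      simp only [h', Finset.mul_sum]
      refine Finset.sum_eq_zero fun j hj => ?_
      linear_combination g i * hS i j (Finset.mem_filter.1 hj).2
    linear_combination hgt i + t i * hh i - h0
  obtain ⟨k, hk, hko, hks⟩ := exists_orthogonal_idempotents_of_countable_classes S
    (fun i => countable_setOf_reflTransGen hr i) (h := h)
    (fun i => by
      rw [IsIdempotentElem]
      linear_combination h i * hh i - hhh i + hhg i)
    (fun i j hij => by
      simp only [h, Finset.sum_mul_sum]
      refine Finset.sum_eq_zero fun a ha => Finset.sum_eq_zero fun b hb => ?_
      rw [Finset.mem_filter] at ha hb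
      have := hS a b fun hab => hij (S.trans ha.2 (S.trans hab (S.symm hb.2)))
      linear_combination g i * g j * this)
  refine ⟨k, hk, hko, hks.trans (le_antisymm ?_ fun x hx => ?_)⟩
  · rw [Ideal.span_le]
    rintro _ ⟨i, rfl⟩
    exact sum_mem fun j _ => Ideal.mul_mem_left _ _ (ht j)
  · obtain ⟨G, -, hG⟩ := hpart x hx
    rw [← hG]
    refine sum_mem fun i _ => Ideal.mul_mem_left _ _ ?_
    rw [← hth i]
    exact Ideal.mul_mem_left _ _ (Ideal.subset_span ⟨i, rfl⟩)

end Orthogonalize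

-- From projectivity to a partition of unity

section Projective

/-- The exchange property for commutative rings: every `t` admits an idempotent `e` divisible by
`t` such that `1 - e` is divisible by `1 - t`. -/
def HasExchangeIdempotents (R : Type*) [CommRing R] : Prop :=
  ∀ t : R, ∃ e c d : R, IsIdempotentElem e ∧ e = c * t ∧ 1 - e = d * (1 - t)

variable {R : Type*} [CommRing R]

theorem HasExchangeIdempotents.quotient (h : HasExchangeIdempotents R) (J : Ideal R) :
    HasExchangeIdempotents (R ⧸ J) := by
  intro t
  obtain ⟨t, rfl⟩ := Ideal.Quotient.mk_surjective t
  obtain ⟨e, c, d, he, hec, hed⟩ := h t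
  refine ⟨Ideal.Quotient.mk J e, Ideal.Quotient.mk J c, Ideal.Quotient.mk J d,
    he.map (Ideal.Quotient.mk J), ?_, ?_⟩
  · rw [hec, map_mul]
  · rw [← map_one (Ideal.Quotient.mk J), ← map_sub, hed, map_mul, map_sub]

/-- Iterates the two-element hypothesis: one element of the ideal detects annihilation of all the
generators. -/
theorem exists_mem_span_annihilating {S : Finset R}
    (h2 : ∀ a b : R, ∃ c d : R, ∀ y, y * (c * a + d * b) = 0 → y * a = 0 ∧ y * b = 0) :
    ∃ z ∈ Ideal.span (S : Set R), ∀ y, y * z = 0 → ∀ a ∈ S, y * a = 0 := by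
  classical
  induction S using Finset.induction_on with
  | empty => exact ⟨0, zero_mem _, by simp⟩
  | insert a S _ ih =>
    obtain ⟨z, hz, hzS⟩ := ih
    obtain ⟨c, d, hcd⟩ := h2 a z
    refine ⟨c * a + d * z, add_mem (Ideal.mul_mem_left _ _ (Ideal.subset_span (by simp)))
      (Ideal.mul_mem_left _ _ (Ideal.span_mono (by simp) hz)), fun y hy b hb => ?_⟩
    obtain ⟨h1, h2⟩ := hcd y hy
    rcases Finset.mem_insert.1 hb with rfl | hb
    · exact h1
    · exact hzS y h2 b hb

/-- Over an exchange ring in which nonzerodivisors are units and finitely generated ideals contain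
an element with the same annihilator, a projective ideal is generated by mutually orthogonal
idempotents. -/
theorem exists_orthogonal_idempotents_of_projective
    (hexch : HasExchangeIdempotents R)
    (h2 : ∀ a b : R, ∃ c d : R, ∀ y, y * (c * a + d * b) = 0 → y * a = 0 ∧ y * b = 0)
    (hunit : ∀ x : R, (∀ y, y * x = 0 → y = 0) → IsUnit x)
    (I : Ideal R) [Module.Projective R I] :
    ∃ k : I → R, (∀ i, IsIdempotentElem (k i)) ∧ (∀ i j, i ≠ j → k i * k j = 0) ∧
      Ideal.span (Set.range k) = I := by
  classical
  obtain ⟨s, hs⟩ := Module.projective_def'.1 (inferInstance : Module.Projective R I)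
  -- The diagonal coordinates of the section. Since `x • p = p • x` in `I`, linearity gives `x * t p
  -- = s x p * p`, whose sum over `p` is `x`.
  let t : I → R := fun p => s p p
  have hst : ∀ (x : R) (hx : x ∈ I) (p : I), x * t p = s ⟨x, hx⟩ p * p := by
    intro x hx p
    have h1 : x * t p = s (x • p) p := by simp [t]
    have h2 : x • p = (p : R) • (⟨x, hx⟩ : I) := Subtype.ext (mul_comm _ _)
    rw [h1, h2, map_smul, Finsupp.smul_apply, smul_eq_mul, mul_comm]
  have hpart : ∀ x ∈ I, ∃ F : Finset I, (∀ i ∉ F, x * t i = 0) ∧ ∑ i ∈ F, x * t i = x := by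
    intro x hx
    refine ⟨(s ⟨x, hx⟩).support, fun i hi => ?_, ?_⟩
    · rw [hst x hx, Finsupp.notMem_support_iff.1 hi, zero_mul]
    · have h := congrArg Subtype.val (LinearMap.congr_fun hs ⟨x, hx⟩)
      simp only [LinearMap.comp_apply, Finsupp.linearCombination_apply, Finsupp.sum, id,
        AddSubmonoidClass.coe_finsetSum, SetLike.val_smul, smul_eq_mul, LinearMap.id_apply] at h
      exact (Finset.sum_congr rfl fun i _ => hst x hx i).trans h
  have hann : ∀ (y : R) (p : I), y * p = 0 → y * t p = 0 := by
    intro y p hy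
    have h1 : y * t p = s (y • p) p := by simp [t]
    have h2 : y • p = 0 := Subtype.ext hy
    rw [h1, h2]
    simp
  have hidem : ∀ x ∈ I, ∃ e ∈ I, IsIdempotentElem e ∧ x * e = x := by
    intro x hx
    obtain ⟨F, -, hF⟩ := hpart x hx
    -- The sum of the `t i` over `F` fixes `x`, and `1 - e` is a multiple of one minus this sum;
    -- hence `x * e = x`. It remains to place `e` in `I`.
    obtain ⟨e, c, d, he, hec, hed⟩ := hexch (∑ i ∈ F, t i)
    rw [← Finset.mul_sum] at hF
    obtain ⟨z, hz, hzF⟩ := exists_mem_span_annihilating (S := F.image Subtype.val) h2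
    have hzI : z ∈ I := by
      refine (Ideal.span_le.2 ?_ : Ideal.span _ ≤ I) hz
      intro a ha
      obtain ⟨p, -, rfl⟩ := Finset.mem_image.1 (Finset.mem_coe.1 ha)
      exact p.2
    -- Whatever kills `z` kills every `p ∈ F`, hence every such `t p`, hence `e`. So `z` is a
    -- nonzerodivisor on the `e` part, and completing by `1 - e` gives a unit; its inverse exhibits
    -- `e` as a multiple of `z ∈ I`.
    have hu : IsUnit (z * e + (1 - e)) := hunit _ fun y hy => by
      have h1 : y * e * z = 0 := by
        linear_combination e * hy - y * (z - 1) * he.eq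
      have h3 : y * e = 0 := by
        have h4 : y * e * ∑ i ∈ F, t i = 0 := by
          rw [Finset.mul_sum]
          exact Finset.sum_eq_zero fun p hp =>
            hann _ p (hzF _ h1 _ (Finset.mem_image_of_mem _ hp))
        linear_combination c * h4 - y * he.eq + y * e * hec
      linear_combination hy + (1 - z) * h3
    obtain ⟨w, hw⟩ := hu.exists_left_inv
    refine ⟨e, ?_, he, ?_⟩
    · have : e = w * e * z := by linear_combination (-e) * hw + w * (z - 1) * he.eq
      rw [this]
      exact Ideal.mul_mem_left _ _ hzI
    · linear_combination (-x) * hed + d * hF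
  refine exists_orthogonal_idempotents_of_partition (t := t) (fun p => ?_) hidem hpart
  -- An idempotent of `I` fixing `p` also fixes `s p`, hence `t p`, which is therefore in `I`.
  obtain ⟨e, heI, -, he⟩ := hidem p p.2
  have h1 : (1 - e) * t p = 0 := hann _ _ (by linear_combination -he)
  have h2 : t p = t p * e := by linear_combination h1
  rw [h2]
  exact Ideal.mul_mem_left _ _ heI

/-- Over such a ring, an ideal is projective if and only if it is generated by mutually orthogonal
idempotents. -/
theorem projective_iff_exists_orthogonal_idempotents {R : Type u} [CommRing R]
    (hexch : HasExchangeIdempotents R)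
    (h2 : ∀ a b : R, ∃ c d : R, ∀ y, y * (c * a + d * b) = 0 → y * a = 0 ∧ y * b = 0)
    (hunit : ∀ x : R, (∀ y, y * x = 0 → y = 0) → IsUnit x) (I : Ideal R) :
    Module.Projective R I ↔ ∃ (ι : Type (max u v)) (e : ι → R),
      (∀ i, IsIdempotentElem (e i)) ∧ (∀ i j, i ≠ j → e i * e j = 0) ∧
        Ideal.span (Set.range e) = I := by
  refine ⟨fun _ => ?_, fun ⟨ι, e, he, ho, hI⟩ => projective_of_orthogonal_idempotents he ho hI⟩
  obtain ⟨k, hk, hko, hks⟩ := exists_orthogonal_idempotents_of_projective hexch h2 hunit I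
  -- The index set `I` is lifted only to reach the required universe.
  refine ⟨ULift.{max u v} I, fun i => k i.down, fun i => hk _, fun i j hij =>
    hko _ _ fun h => hij (ULift.down_injective h), ?_⟩
  exact (congrArg Ideal.span (ULift.down_surjective.range_comp k)).trans hks

end Projective

-- The three ring properties for generalized numbers

section GenNumber

open Filter

variable {𝕜 : Type*} [RCLike 𝕜]

theorem eventuallyLe_iff {x : Set.Ioo (0 : ℝ) 1 → 𝕜} {a : ℝ} :
    EventuallyLe x a ↔ ∀ᶠ ε in atBot, ‖x ε‖ ≤ (ε : ℝ) ^ a := by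
  have : Nonempty (Set.Ioo (0 : ℝ) 1) := ⟨⟨1 / 2, by norm_num, by norm_num⟩⟩
  exact eventually_atBot.symm

theorem eventually_coe_lt {b : ℝ} (hb : 0 < b) :
    ∀ᶠ ε : Set.Ioo (0 : ℝ) 1 in atBot, (ε : ℝ) < b := by
  have hm : min (b / 2) (1 / 2) ∈ Set.Ioo (0 : ℝ) 1 :=
    ⟨by positivity, (min_le_right _ _).trans_lt (by norm_num)⟩
  filter_upwards [eventually_le_atBot (⟨_, hm⟩ : Set.Ioo (0 : ℝ) 1)] with ε hε
  have h : (ε : ℝ) ≤ min (b / 2) (1 / 2) := hε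
  linarith [min_le_left (b / 2) (1 / 2 : ℝ)]

theorem mem_moderate_of_norm_le_two {x : Set.Ioo (0 : ℝ) 1 → 𝕜} (hx : ∀ ε, ‖x ε‖ ≤ 2) :
    x ∈ moderate 𝕜 := by
  refine ⟨-1, eventuallyLe_iff.2 ?_⟩
  filter_upwards [eventually_coe_lt (b := 1 / 2) (by norm_num)] with ε hε
  refine (hx ε).trans ?_
  rw [Real.rpow_neg_one, le_inv_comm₀ (by norm_num) ε.2.1]
  linarith

theorem mk_eq_zero_iff {x : moderate 𝕜} :
    (Ideal.Quotient.mk (negligible 𝕜) x = 0) ↔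
      ∀ a : ℝ, ∀ᶠ ε in atBot, ‖x.1 ε‖ ≤ (ε : ℝ) ^ a := by
  rw [Ideal.Quotient.eq_zero_iff_mem]
  exact forall_congr' fun a => eventuallyLe_iff

open Classical in
/-- The generalized number represented by the indicator function of `S`. -/
noncomputable def indicatorNet (𝕜 : Type*) [RCLike 𝕜] (S : Set (Set.Ioo (0 : ℝ) 1)) : moderate 𝕜 :=
  ⟨fun ε => if ε ∈ S then 1 else 0, mem_moderate_of_norm_le_two fun ε => by
    split_ifs <;> simp⟩

theorem indicatorNet_idempotent (S : Set (Set.Ioo (0 : ℝ) 1)) :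
    IsIdempotentElem (indicatorNet 𝕜 S) :=
  Subtype.ext (funext fun ε => by simp [indicatorNet])

/-- At every `ε` either `t` or `1 - t` has norm at least `1 / 2`. The indicator of the set where `t`
does is the idempotent, and the relevant inverses are bounded by `2`, hence moderate. -/
theorem hasExchangeIdempotents_moderate : HasExchangeIdempotents (moderate 𝕜) := by
  classical
  intro t
  let S : Set (Set.Ioo (0 : ℝ) 1) := {ε | 1 / 2 ≤ ‖t.1 ε‖}
  have hS : ∀ ε ∉ S, 1 / 2 ≤ ‖1 - t.1 ε‖ := fun ε hε => by
    have h1 : ‖t.1 ε‖ < 1 / 2 := not_le.1 hε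
    have h2 := norm_sub_norm_le (1 : 𝕜) (t.1 ε)
    rw [norm_one] at h2
    linarith
  have hinv : ∀ z : 𝕜, 1 / 2 ≤ ‖z‖ → ‖z⁻¹‖ ≤ 2 := fun z hz => by
    rw [norm_inv, inv_le_comm₀ (by linarith) (by norm_num)]
    linarith
  have hne : ∀ z : 𝕜, 1 / 2 ≤ ‖z‖ → z ≠ 0 := fun z hz h0 => by
    rw [h0, norm_zero] at hz
    linarith
  let c : moderate 𝕜 := ⟨fun ε => if ε ∈ S then (t.1 ε)⁻¹ else 0,
    mem_moderate_of_norm_le_two fun ε => by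
      split_ifs with h
      · exact hinv _ h
      · simp⟩
  let d : moderate 𝕜 := ⟨fun ε => if ε ∈ S then 0 else (1 - t.1 ε)⁻¹,
    mem_moderate_of_norm_le_two fun ε => by
      split_ifs with h
      · simp
      · exact hinv _ (hS ε h)⟩
  have h1 : indicatorNet 𝕜 S = c * t := Subtype.ext <| funext fun ε => by
    by_cases h : ε ∈ S
    · simp [indicatorNet, c, h, inv_mul_cancel₀ (hne _ h)]
    · simp [indicatorNet, c, h]
  have h2 : 1 - indicatorNet 𝕜 S = d * (1 - t) := Subtype.ext <| funext fun ε => by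
    by_cases h : ε ∈ S
    · simp [indicatorNet, d, h]
    · simp [indicatorNet, d, h, inv_mul_cancel₀ (hne _ (hS ε h))]
  exact ⟨indicatorNet 𝕜 S, c, d, indicatorNet_idempotent S, h1, h2⟩

theorem star_mem_moderate (a : moderate 𝕜) : star a.1 ∈ moderate 𝕜 := by
  obtain ⟨r, ε₀, h⟩ := a.2
  exact ⟨r, ε₀, fun ε hε => by simpa using h ε hε⟩

/-- Negligibility survives a square root: `(‖y‖ * ‖a‖) ^ 2 ≤ ‖y‖ * ‖y * w‖`, a moderate net times a
negligible one. The exponent `2 * r - b` compensates the growth `b` of `y`. -/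
theorem mk_mul_eq_zero_of_norm_sq_le {y a w : moderate 𝕜}
    (hw : Ideal.Quotient.mk (negligible 𝕜) (y * w) = 0)
    (haw : ∀ ε, ‖a.1 ε‖ ^ 2 ≤ ‖w.1 ε‖) : Ideal.Quotient.mk (negligible 𝕜) (y * a) = 0 := by
  rw [mk_eq_zero_iff] at hw ⊢
  obtain ⟨b, hb⟩ := y.2
  intro r
  filter_upwards [hw (2 * r - b), eventuallyLe_iff.1 hb] with ε h1 h2
  have h0 : (0 : ℝ) < (ε : ℝ) := ε.2.1
  have hy := norm_nonneg (y.1 ε)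
  have e1 : ‖(y * w).1 ε‖ = ‖y.1 ε‖ * ‖w.1 ε‖ := norm_mul _ _
  have e2 : ‖(y * a).1 ε‖ = ‖y.1 ε‖ * ‖a.1 ε‖ := norm_mul _ _
  rw [e1] at h1
  rw [e2]
  refine le_of_sq_le_sq ?_ (Real.rpow_nonneg h0.le _)
  have e3 : ((ε : ℝ) ^ r) ^ 2 = (ε : ℝ) ^ b * (ε : ℝ) ^ (2 * r - b) := by
    rw [← Real.rpow_add h0, ← Real.rpow_natCast, ← Real.rpow_mul h0.le]
    congr 1
    push_cast
    ring
  rw [e3]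
  calc (‖y.1 ε‖ * ‖a.1 ε‖) ^ 2 = ‖y.1 ε‖ * (‖y.1 ε‖ * ‖a.1 ε‖ ^ 2) := by ring
    _ ≤ ‖y.1 ε‖ * (‖y.1 ε‖ * ‖w.1 ε‖) := by gcongr; exact haw ε
    _ ≤ _ := mul_le_mul h2 h1 (by positivity) (Real.rpow_nonneg h0.le _)

/-- Any two generalized numbers have a combination with the same annihilator. -/
theorem GenNumber.exists_combination_annihilating (a b : GenNumber 𝕜) :
    ∃ c d : GenNumber 𝕜, ∀ y, y * (c * a + d * b) = 0 → y * a = 0 ∧ y * b = 0 := by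
  obtain ⟨a, rfl⟩ := Ideal.Quotient.mk_surjective a
  obtain ⟨b, rfl⟩ := Ideal.Quotient.mk_surjective b
  -- With conjugates as coefficients the combination is `‖a‖ ^ 2 + ‖b‖ ^ 2`, which dominates both
  -- squares.
  let c : moderate 𝕜 := ⟨_, star_mem_moderate a⟩
  let d : moderate 𝕜 := ⟨_, star_mem_moderate b⟩
  refine ⟨Ideal.Quotient.mk _ c, Ideal.Quotient.mk _ d, fun y hy => ?_⟩
  obtain ⟨y, rfl⟩ := Ideal.Quotient.mk_surjective y
  have hn : ∀ ε, ‖(c * a + d * b).1 ε‖ = ‖a.1 ε‖ ^ 2 + ‖b.1 ε‖ ^ 2 := fun ε => by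
    have : (c * a + d * b).1 ε = ((‖a.1 ε‖ ^ 2 + ‖b.1 ε‖ ^ 2 : ℝ) : 𝕜) := by
      change star (a.1 ε) * a.1 ε + star (b.1 ε) * b.1 ε = _
      simp [RCLike.conj_mul]
    rw [this, RCLike.norm_ofReal, abs_of_nonneg (by positivity)]
  rw [← map_mul, ← map_mul, ← map_add, ← map_mul] at hy
  rw [← map_mul, ← map_mul]
  exact ⟨mk_mul_eq_zero_of_norm_sq_le hy fun ε => by rw [hn]; linarith [sq_nonneg ‖b.1 ε‖],
    mk_mul_eq_zero_of_norm_sq_le hy fun ε => by rw [hn]; linarith [sq_nonneg ‖a.1 ε‖]⟩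

/-- A generalized number that is not a zero divisor is invertible. -/
theorem GenNumber.isUnit_of_forall_mul_eq_zero (x : GenNumber 𝕜)
    (hx : ∀ y, y * x = 0 → y = 0) : IsUnit x := by
  classical
  have : Nonempty (Set.Ioo (0 : ℝ) 1) := ⟨⟨1 / 2, by norm_num, by norm_num⟩⟩
  obtain ⟨x, rfl⟩ := Ideal.Quotient.mk_surjective x
  by_cases h : ∃ n : ℕ, ∀ᶠ ε : Set.Ioo (0 : ℝ) 1 in atBot, (ε : ℝ) ^ (n : ℝ) ≤ ‖x.1 ε‖
  · obtain ⟨n, hn⟩ := h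
    -- Where `x` vanishes the inverse is `0` by convention; this is harmless, since it does not
    -- happen for small `ε`.
    let y : moderate 𝕜 := ⟨fun ε => (x.1 ε)⁻¹, -n, eventuallyLe_iff.2 <| by
      filter_upwards [hn] with ε hε
      rw [norm_inv, Real.rpow_neg ε.2.1.le]
      exact inv_anti₀ (Real.rpow_pos_of_pos ε.2.1 _) hε⟩
    refine IsUnit.of_mul_eq_one (Ideal.Quotient.mk _ y) ?_
    rw [← map_mul, ← sub_eq_zero, ← map_one (Ideal.Quotient.mk (negligible 𝕜)), ← map_sub,
      mk_eq_zero_iff]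
    intro a
    filter_upwards [hn] with ε hε
    have hne : x.1 ε ≠ 0 := norm_pos_iff.1 ((Real.rpow_pos_of_pos ε.2.1 _).trans_le hε)
    have : (x * y - 1).1 ε = 0 := by
      change x.1 ε * (x.1 ε)⁻¹ - 1 = 0
      rw [mul_inv_cancel₀ hne, sub_self]
    rw [this, norm_zero]
    exact Real.rpow_nonneg ε.2.1.le _
  · exfalso
    push Not at h
    -- If no power of `ε` bounds `‖x‖` below, there are points `f n` tending to `0` with `‖x (f n)‖
    -- < (f n) ^ n`. The indicator of these points will annihilate `x` without being zero.
    have h' : ∀ n : ℕ, ∃ ε : Set.Ioo (0 : ℝ) 1, (ε : ℝ) < 1 / ((n : ℝ) + 1) ∧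
        ‖x.1 ε‖ < (ε : ℝ) ^ (n : ℝ) := fun n => by
      obtain ⟨ε, h1, h2⟩ := ((h n).and_eventually
        (eventually_coe_lt (b := 1 / ((n : ℝ) + 1)) (by positivity))).exists
      exact ⟨ε, h2, h1⟩
    choose f hf hfx using h'
    have h1 : Ideal.Quotient.mk (negligible 𝕜) (indicatorNet 𝕜 (Set.range f) * x) = 0 := by
      rw [mk_eq_zero_iff]
      intro a
      obtain ⟨N, hN⟩ := exists_nat_ge a
      -- Small `ε` avoid the finitely many points `f n` with `n < N`; at the others the exponent is
      -- at least `a`.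
      have hev : ∀ᶠ ε : Set.Ioo (0 : ℝ) 1 in atBot, ∀ n ∈ Finset.range N, ε < f n :=
        (Finset.eventually_all _).2 fun n _ => eventually_lt_atBot _
      filter_upwards [hev] with ε hε
      by_cases hS : ε ∈ Set.range f
      · obtain ⟨n, rfl⟩ := hS
        have hn : N ≤ n := by
          by_contra hlt
          exact lt_irrefl _ (hε n (Finset.mem_range.2 (not_le.1 hlt)))
        have : (indicatorNet 𝕜 (Set.range f) * x).1 (f n) = x.1 (f n) := by
          simp [indicatorNet]
        rw [this]
        refine (hfx n).le.trans (Real.rpow_le_rpow_of_exponent_ge (f n).2.1 (f n).2.2.le ?_)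
        exact hN.trans (by exact_mod_cast hn)
      · have : (indicatorNet 𝕜 (Set.range f) * x).1 ε = 0 := by
          simp only [indicatorNet, Subring.coe_mul, Pi.mul_apply, if_neg hS, zero_mul]
        rw [this, norm_zero]
        exact Real.rpow_nonneg ε.2.1.le _
    -- Exponent `1` suffices: the indicator is `1` at `f n`, while negligibility would force `1 ≤ f
    -- n`.
    have h2 := mk_eq_zero_iff.1 (hx _ (by rwa [← map_mul])) 1
    obtain ⟨ε₀, hε₀⟩ := eventually_atBot.1 h2
    obtain ⟨n, hn⟩ := exists_nat_one_div_lt ε₀.2.1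
    have h3 := hε₀ (f n) (((hf n).trans hn).le)
    have h4 : ‖(indicatorNet 𝕜 (Set.range f)).1 (f n)‖ = 1 := by simp [indicatorNet]
    rw [h4, Real.rpow_one] at h3
    exact absurd (f n).2.2 (not_lt.2 h3)

end GenNumber

end Colombeau

theorem mainTheorem12 (𝕜 : Type u) [RCLike 𝕜] (I : Ideal (Colombeau.GenNumber 𝕜)) :
    (Module.Projective (Colombeau.GenNumber 𝕜) I ↔
      ∃ (ι : Type (max u v)) (e : ι → Colombeau.GenNumber 𝕜),
        (∀ i, IsIdempotentElem (e i)) ∧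
        Colombeau.IsDirectSumOf I (fun i => Ideal.span {e i})) ∧
    (Module.Projective (Colombeau.GenNumber 𝕜) I ↔
      ∃ (ι : Type (max u v)) (e : ι → Colombeau.GenNumber 𝕜),
        (∀ i, IsIdempotentElem (e i)) ∧
        (∀ i j, i ≠ j → e i * e j = 0) ∧
        Ideal.span (Set.range e) = I) := by
  have key := Colombeau.projective_iff_exists_orthogonal_idempotents.{u, v}
    (Colombeau.hasExchangeIdempotents_moderate.quotient _)
    Colombeau.GenNumber.exists_combination_annihilating
    Colombeau.GenNumber.isUnit_of_forall_mul_eq_zero I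
  refine ⟨key.trans (exists_congr fun ι => exists_congr fun e => and_congr_right fun he => ?_), key⟩
  exact (Colombeau.isDirectSumOf_span_singleton_iff he).symm
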